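/- Let $L\ge 1$ be an integer, let $a_0,a_1,a_2,\dots$ be independent standard complex Gaussian random variables (real and imaginary parts independent, centred, of variance $1/2$, so $E a_m=0$, $E|a_m|^2=1$, $E a_m^2=0$), and let $$\psi(z)=\sum_{m=0}^{\infty}\sqrt{\binom{m+L-1}{m}}\;a_m z^m,\qquad |z|<1,$$ be the $SU(1,1)$ random analytic function. Almost surely the series converges for all $z$ in the unit disk $\mathbb D=\{|z|<1\}$, and the zeros of $\psi$ in $\mathbb D$, counted with multiplicity, do not accumulate in $\mathbb D$, so that $Z=\sum_{\zeta\in\mathbb D:\,\psi(\zeta)=0}\operatorname{mult}(\zeta)\,\delta_\zeta$ is a locally finite random measure on $\mathbb D$; moreover $E\,\psi(z)\overline{\psi(z')}=(1-z\overline{z'})^{-L}$ for all $z,z'\in\mathbb D$. Let $SU(1,1)$ be the group of complex $2\times2$ matrices $A=\begin{pmatrix}a&b\\c&d\end{pmatrix}$ with $\det A=1$ that preserve the form $z_0\overline{z_0'}-z_1\overline{z_1'}$, acting on $\mathbb D$ by $Az=\frac{az+b}{cz+d}$. Then for every $A\in SU(1,1)$ the distribution of the zeros of $\psi$ is invariant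 under $A$: the random measures $\sum_{\zeta}\operatorname{mult}(\zeta)\,\delta_{A\zeta}$ and $Z$ have the same law. Consequently all joint distributions of zeros are $SU(1,1)$-invariant: for all $n$ and all Borel sets $B_1,\dots,B_n\subseteq\mathbb D$ the random vectors $(Z(AB_1),\dots,Z(AB_n))$ and $(Z(B_1),\dots,Z(B_n))$ have the same law, and for all Borel functions $\varphi_1,\dots,\varphi_n:\mathbb D\to[0,\infty]$, $$E\prod_{p=1}^n\Big(\sum_{\zeta}\varphi_p(A\zeta)\Big)=E\prod_{p=1}^n\Big(\sum_{\zeta}\varphi_p(\zeta)\Big),$$ where the sums run over the zeros $\zeta$ of $\psi$ in $\mathbb D$, repeated according to multiplicity. -/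

import Mathlib

open MeasureTheory ProbabilityTheory Complex
open scoped ENNReal Matrix ComplexConjugate Complex.UnitDisc

noncomputable section

/-- The open unit disk `𝔻` carries its Borel σ-algebra. -/
instance unitDiscMeasurableSpace : MeasurableSpace 𝔻 := borel 𝔻

instance unitDiscBorelSpace : BorelSpace 𝔻 := ⟨rfl⟩

/-- The matrix of the indefinite Hermitian form `z₀ conj z₀' - z₁ conj z₁'`. -/
def formJ : Matrix (Fin 2) (Fin 2) ℂ := !![1, 0; 0, -1]

/-- The group `SU(1,1)`: complex 2 × 2 matrices of determinant one which preserve the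
Hermitian form of signature `(1,1)`. -/
def SU11 : Subgroup (Matrix.SpecialLinearGroup (Fin 2) ℂ) where
  carrier := {A | (A.1)ᴴ * formJ * A.1 = formJ}
  one_mem' := by simp
  mul_mem' := by
    intro A B hA hB
    simp only [Set.mem_ofPred_eq] at hA hB ⊢
    rw [Matrix.SpecialLinearGroup.coe_mul, Matrix.conjTranspose_mul]
    calc (B.1)ᴴ * (A.1)ᴴ * formJ * (A.1 * B.1)
        = (B.1)ᴴ * ((A.1)ᴴ * formJ * A.1) * B.1 := by simp only [Matrix.mul_assoc]
      _ = formJ := by rw [hA, hB]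
  inv_mem' := by
    intro A hA
    simp only [Set.mem_ofPred_eq] at hA ⊢
    have h1 : A.1 * (A⁻¹).1 = 1 := by
      rw [← Matrix.SpecialLinearGroup.coe_mul, mul_inv_cancel]; rfl
    have h2 : ((A⁻¹).1)ᴴ * (A.1)ᴴ = 1 := by
      rw [← Matrix.conjTranspose_mul, h1, Matrix.conjTranspose_one]
    calc ((A⁻¹).1)ᴴ * formJ * (A⁻¹).1
        = ((A⁻¹).1)ᴴ * ((A.1)ᴴ * formJ * A.1) * (A⁻¹).1 := by rw [hA]
      _ = (((A⁻¹).1)ᴴ * (A.1)ᴴ) * formJ * (A.1 * (A⁻¹).1) := by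
          simp only [Matrix.mul_assoc]
      _ = formJ := by rw [h1, h2, Matrix.one_mul, Matrix.mul_one]

/-- Numerator of the Möbius transformation `z ↦ (a z + b) / (c z + d)`. -/
def mobNum (A : Matrix (Fin 2) (Fin 2) ℂ) (z : ℂ) : ℂ := A 0 0 * z + A 0 1

/-- Denominator of the Möbius transformation `z ↦ (a z + b) / (c z + d)`. -/
def mobDen (A : Matrix (Fin 2) (Fin 2) ℂ) (z : ℂ) : ℂ := A 1 0 * z + A 1 1

theorem SU11.normSq_sub (A : SU11) (z : ℂ) :
    normSq (mobNum A.1.1 z) - normSq (mobDen A.1.1 z) = normSq z - 1 := by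
  have hA : (A.1.1)ᴴ * formJ * A.1.1 = formJ := A.2
  have h00 := congrFun (congrFun hA 0) 0
  have h01 := congrFun (congrFun hA 0) 1
  have h10 := congrFun (congrFun hA 1) 0
  have h11 := congrFun (congrFun hA 1) 1
  simp [formJ, Matrix.mul_apply, Fin.sum_univ_two] at h00 h01 h10 h11
  have key : (normSq (mobNum A.1.1 z) : ℂ) - normSq (mobDen A.1.1 z) = normSq z - 1 := by
    simp only [Complex.normSq_eq_conj_mul_self, mobNum, mobDen, map_add, map_mul]
    linear_combination (conj z * z) * h00 + conj z * h01 + z * h10 + h11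
  exact_mod_cast key

theorem SU11.normSq_lt (A : SU11) (z : 𝔻) :
    normSq (mobNum A.1.1 z) < normSq (mobDen A.1.1 z) := by
  have h := SU11.normSq_sub A z
  have h' := z.normSq_lt_one
  linarith

theorem SU11.den_ne_zero (A : SU11) (z : 𝔻) : mobDen A.1.1 z ≠ 0 := by
  intro h
  have h1 := SU11.normSq_lt A z
  rw [h, map_zero] at h1
  exact absurd h1 (not_lt.mpr (normSq_nonneg _))

theorem SU11.norm_lt_one (A : SU11) (z : 𝔻) :
    ‖mobNum A.1.1 z / mobDen A.1.1 z‖ < 1 := by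
  rw [norm_div, div_lt_one (norm_pos_iff.mpr (SU11.den_ne_zero A z))]
  have h := SU11.normSq_lt A z
  rw [normSq_eq_norm_sq, normSq_eq_norm_sq] at h
  exact lt_of_pow_lt_pow_left₀ 2 (norm_nonneg _) h

/-- The Möbius action of `SU(1,1)` on the unit disk: the matrix with rows `(a, b)` and `(c, d)`
sends `z` to `(a z + b) / (c z + d)`. -/
instance SU11.instMulAction : MulAction SU11 𝔻 where
  smul A z := UnitDisc.mk (mobNum A.1.1 z / mobDen A.1.1 z) (SU11.norm_lt_one A z)
  one_smul z := by
    apply UnitDisc.coe_injective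
    change mobNum (1 : Matrix (Fin 2) (Fin 2) ℂ) z / mobDen (1 : Matrix (Fin 2) (Fin 2) ℂ) z = z
    simp [mobNum, mobDen]
  mul_smul A B z := by
    apply UnitDisc.coe_injective
    have hB := SU11.den_ne_zero B z
    have hA := SU11.den_ne_zero A
      (UnitDisc.mk (mobNum B.1.1 z / mobDen B.1.1 z) (SU11.norm_lt_one B z))
    have hAB := SU11.den_ne_zero (A * B) z
    change mobDen A.1.1 (mobNum B.1.1 z / mobDen B.1.1 z) ≠ 0 at hA
    change mobDen (A.1.1 * B.1.1) z ≠ 0 at hAB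
    change mobNum (A.1.1 * B.1.1) z / mobDen (A.1.1 * B.1.1) z
      = mobNum A.1.1 (mobNum B.1.1 z / mobDen B.1.1 z)
        / mobDen A.1.1 (mobNum B.1.1 z / mobDen B.1.1 z)
    have e1 : mobNum (A.1.1 * B.1.1) z
        = mobNum A.1.1 (mobNum B.1.1 z / mobDen B.1.1 z) * mobDen B.1.1 z := by
      have : mobNum B.1.1 z / mobDen B.1.1 z * mobDen B.1.1 z = mobNum B.1.1 z :=
        div_mul_cancel₀ _ hB
      unfold mobNum at this ⊢
      rw [add_mul, mul_assoc, this]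
      simp [mobDen, Matrix.mul_apply, Fin.sum_univ_two]
      ring
    have e2 : mobDen (A.1.1 * B.1.1) z
        = mobDen A.1.1 (mobNum B.1.1 z / mobDen B.1.1 z) * mobDen B.1.1 z := by
      have : mobNum B.1.1 z / mobDen B.1.1 z * mobDen B.1.1 z = mobNum B.1.1 z :=
        div_mul_cancel₀ _ hB
      conv_rhs => rw [mobDen, add_mul, mul_assoc, this]
      simp [mobNum, mobDen, Matrix.mul_apply, Fin.sum_univ_two]
      ring
    rw [e1, e2, mul_div_mul_right _ _ hB]

theorem SU11.coe_smul (A : SU11) (z : 𝔻) :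
    ((A • z : 𝔻) : ℂ) = (A.1.1 0 0 * z + A.1.1 0 1) / (A.1.1 1 0 * z + A.1.1 1 1) := rfl

/-- The standard complex Gaussian law: real and imaginary parts are independent real centred
Gaussians of variance `1/2`, so that `E ξ = 0`, `E |ξ|² = 1` and `E ξ² = 0`. -/
def stdComplexGaussian : Measure ℂ :=
  ((gaussianReal 0 (1 / 2)).prod (gaussianReal 0 (1 / 2))).map
    (fun p : ℝ × ℝ => (⟨p.1, p.2⟩ : ℂ))

/-- The `m`-th term `√(C(m+L-1, m)) a_m z^m` of the `SU(1,1)` random series (`L ≥ 1`). -/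
def su11Term (L : ℕ) (a : ℕ → ℂ) (z : ℂ) (m : ℕ) : ℂ :=
  (Real.sqrt ((m + L - 1).choose m : ℝ) : ℂ) * a m * z ^ m

/-- The analytic function `ψ(z) = ∑ₘ √(C(m+L-1, m)) a_m z^m` with coefficient sequence `a`. -/
def su11Fun (L : ℕ) (a : ℕ → ℂ) (z : ℂ) : ℂ := ∑' m, su11Term L a z m

/-- The zeros of `f` in the unit disk, counted with multiplicity, as a counting measure:
the sum of `ord_z(f) • δ_z` over the points `z` of the disk. -/
def zeroMeasure (f : ℂ → ℂ) : Measure 𝔻 :=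
  Measure.sum fun z : 𝔻 => ((analyticOrderAt f (z : ℂ) : ℕ∞) : ℝ≥0∞) • Measure.dirac z

end

/-! A Gaussian function is determined in law by its covariance, here `K(z, w) = (1 - z conj
w)^(-L)`. Preservation of the form by `A`, tested on the vectors `(z, 1)` and `(w, 1)`, shows that
the weighted function `(c z + d)^(-L) ψ(A z)` has the same covariance (`SU11.pullback_kernel`),
hence the same joint law at any finite set of points. The weight has no zeros and `A` is a
biholomorphic bijection of the disk, so the zeros of this function are the preimages under `A` of
those of `ψ`, with the same multiplicities (`SU11.map_zeroMeasure_pullback`).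

Equality in law of values passes to zeros only if the zero measure is a measurable function of the
values on a dense sequence. This rests on Jensen's formula: the number of zeros in a closed disk is
the right derivative, in `log r`, of the circle average of `log |f|` (`exists_zeroCount`). Finite
disjoint families of small closed disks then give open sets, and a π-system argument gives Borel
sets (`measurable_zeroMeasure`).

Gaussianity enters through one formula, `integral_cexp_series`: a series `∑ a_m c_m` has
characteristic function governed by `∑ |c_m|²` alone. -/

open Filter
open scoped Topology

noncomputable section

/-! ### Characteristic functions and second moments of Gaussian series. -/

instance : IsProbabilityMeasure stdComplexGaussian := by
  unfold stdComplexGaussian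
  exact Measure.isProbabilityMeasure_map
    (Complex.measurableEquivRealProd.symm.measurable.aemeasurable)

theorem measurable_mk_complex : Measurable fun p : ℝ × ℝ => (⟨p.1, p.2⟩ : ℂ) :=
  Complex.measurableEquivRealProd.symm.measurable

/-- With `z = x + i y`, `Re (z c) = x Re c - y Im c`; independent `x`, `y` of variance `1/2`
contribute `exp(-(Re c)²/4)` and `exp(-(Im c)²/4)`. -/
theorem integral_cexp_stdComplexGaussian (c : ℂ) :
    ∫ z, cexp ((z * c).re * I) ∂stdComplexGaussian = cexp (-(‖c‖ ^ 2 / 4 : ℝ)) := by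
  unfold stdComplexGaussian
  rw [integral_map measurable_mk_complex.aemeasurable
    (by apply Measurable.aestronglyMeasurable; fun_prop)]
  have e : ∀ p : ℝ × ℝ, cexp ((((⟨p.1, p.2⟩ : ℂ) * c).re : ℂ) * I)
      = cexp ((c.re : ℝ) * p.1 * I) * cexp ((-c.im : ℝ) * p.2 * I) := by
    intro p
    rw [← Complex.exp_add]
    congr 1
    simp only [mul_re]
    push_cast
    ring
  simp_rw [e]
  rw [integral_prod_mul (fun x : ℝ => cexp ((c.re : ℝ) * x * I))
    (fun x : ℝ => cexp ((-c.im : ℝ) * x * I)), ← charFun_apply_real, ← charFun_apply_real,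
    charFun_gaussianReal, charFun_gaussianReal, ← Complex.exp_add]
  congr 1
  rw [← Complex.normSq_eq_norm_sq, Complex.normSq_apply]
  push_cast
  simp
  ring

theorem stdComplexGaussian_singleton_zero : stdComplexGaussian {0} = 0 := by
  unfold stdComplexGaussian
  rw [Measure.map_apply measurable_mk_complex (measurableSet_singleton 0)]
  have : (fun p : ℝ × ℝ => (⟨p.1, p.2⟩ : ℂ)) ⁻¹' {0} = {0} ×ˢ {0} := by
    ext p
    simp [Complex.ext_iff, Prod.ext_iff]
  have h : NullSingletonClass (gaussianReal 0 (1 / 2)) :=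
    nullSingletonClass_gaussianReal (by norm_num)
  rw [this, Measure.prod_prod, measure_singleton, zero_mul]

section

variable {Ω : Type*} [MeasurableSpace Ω] {P : Measure Ω} {a : ℕ → Ω → ℂ}

theorem integral_cexp_partialSum (ha : ∀ m, HasLaw (a m) stdComplexGaussian P)
    (hindep : iIndepFun a P) (c : ℕ → ℂ) (N : ℕ) :
    ∫ ω, cexp ((∑ m ∈ Finset.range N, a m ω * c m).re * I) ∂P
      = cexp (-((∑ m ∈ Finset.range N, ‖c m‖ ^ 2) / 4 : ℝ)) := by
  have hi : iIndepFun (fun (m : Fin N) ω => cexp ((a m ω * c m).re * I)) P := by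
    have h1 := hindep.precomp (g := fun m : Fin N => (m : ℕ)) Fin.val_injective
    exact h1.comp (fun (m : Fin N) (z : ℂ) => cexp ((z * c m).re * I)) (fun m => by fun_prop)
  have e : ∀ ω, cexp ((∑ m ∈ Finset.range N, a m ω * c m).re * I)
      = ∏ m : Fin N, cexp ((a m ω * c m).re * I) := by
    intro ω
    rw [← Complex.exp_sum, ← Finset.sum_mul, ← Complex.ofReal_sum, ← Complex.re_sum,
      Finset.sum_range]
  simp_rw [e]
  rw [hi.integral_fun_prod_eq_prod_integral (fun m => by
    have := (ha m).aemeasurable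
    apply AEMeasurable.aestronglyMeasurable; fun_prop)]
  have h : ∀ m : Fin N, ∫ ω, cexp ((a m ω * c m).re * I) ∂P = cexp (-(‖c m‖ ^ 2 / 4 : ℝ)) := by
    intro m
    rw [← integral_cexp_stdComplexGaussian, ← (ha m).map_eq,
      integral_map (ha m).aemeasurable (by apply Measurable.aestronglyMeasurable; fun_prop)]
  simp_rw [h]
  rw [← Complex.exp_sum, Finset.sum_range]
  congr 1
  push_cast
  rw [Finset.sum_neg_distrib, Finset.sum_div]

theorem aemeasurable_of_series (ha : ∀ m, HasLaw (a m) stdComplexGaussian P)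
    {c : ℕ → ℂ} {S : Ω → ℂ} (hS : ∀ᵐ ω ∂P, HasSum (fun m => a m ω * c m) (S ω)) :
    AEMeasurable S P := by
  refine aemeasurable_of_tendsto_metrizable_ae atTop
    (f := fun N ω => ∑ m ∈ Finset.range N, a m ω * c m) (fun N => ?_)
    (hS.mono fun ω h => h.tendsto_sum_nat)
  have := fun m => (ha m).aemeasurable
  fun_prop

/-- Independence gives the partial sums; the integrands have modulus one, so dominated convergence
passes to the limit. -/
theorem integral_cexp_series [IsProbabilityMeasure P] (ha : ∀ m, HasLaw (a m) stdComplexGaussian P)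
    (hindep : iIndepFun a P) {c : ℕ → ℂ} {V : ℝ} (hc : HasSum (fun m => ‖c m‖ ^ 2) V)
    {S : Ω → ℂ} (hS : ∀ᵐ ω ∂P, HasSum (fun m => a m ω * c m) (S ω)) :
    ∫ ω, cexp ((S ω).re * I) ∂P = cexp (-(V / 4 : ℝ)) := by
  have hm := fun m => (ha m).aemeasurable
  have h1 : Tendsto (fun N => ∫ ω, cexp ((∑ m ∈ Finset.range N, a m ω * c m).re * I) ∂P) atTop
      (𝓝 (∫ ω, cexp ((S ω).re * I) ∂P)) := by
    refine tendsto_integral_of_dominated_convergence (fun _ => (1 : ℝ)) (fun N => ?_)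
      (integrable_const _) (fun N => ?_) ?_
    · apply AEMeasurable.aestronglyMeasurable; fun_prop
    · exact Eventually.of_forall fun ω => (Complex.norm_exp_ofReal_mul_I _).le
    · filter_upwards [hS] with ω h
      have h' := h.tendsto_sum_nat
      have : Continuous fun z : ℂ => cexp (z.re * I) := by fun_prop
      exact (this.tendsto _).comp h'
  simp_rw [integral_cexp_partialSum ha hindep] at h1
  refine tendsto_nhds_unique h1 ?_
  have h2 := hc.tendsto_sum_nat
  have : Continuous fun x : ℝ => cexp (-(x / 4 : ℝ)) := by fun_prop
  exact (this.tendsto V).comp h2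

theorem map_re_series [IsProbabilityMeasure P] (ha : ∀ m, HasLaw (a m) stdComplexGaussian P)
    (hindep : iIndepFun a P) {c : ℕ → ℂ} {V : NNReal} (hc : HasSum (fun m => ‖c m‖ ^ 2) (V : ℝ))
    {S : Ω → ℂ} (hS : ∀ᵐ ω ∂P, HasSum (fun m => a m ω * c m) (S ω)) :
    P.map (fun ω => (S ω).re) = gaussianReal 0 (V / 2) := by
  have hm := aemeasurable_of_series ha hS
  have : AEMeasurable (fun ω => (S ω).re) P := by fun_prop
  have := Measure.isProbabilityMeasure_map this
  apply Measure.ext_of_charFun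
  ext t
  rw [charFun_gaussianReal, charFun_apply_real, integral_map (by fun_prop)
    (by apply Measurable.aestronglyMeasurable; fun_prop)]
  have hc' : HasSum (fun m => ‖t * c m‖ ^ 2) (t ^ 2 * V) := by
    convert! hc.mul_left (t ^ 2) using 2 with m
    rw [norm_mul, mul_pow]
    simp
  have hS' : ∀ᵐ ω ∂P, HasSum (fun m => a m ω * (t * c m)) (t * S ω) := by
    filter_upwards [hS] with ω h
    convert! h.mul_left (t : ℂ) using 2 with m
    ring
  have := integral_cexp_series ha hindep hc' hS'
  convert this using 1
  · simp
  · congr 1; push_cast; ring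

theorem integral_re_sq_series [IsProbabilityMeasure P] (ha : ∀ m, HasLaw (a m) stdComplexGaussian P)
    (hindep : iIndepFun a P) {c : ℕ → ℂ} {V : ℝ} (hc : HasSum (fun m => ‖c m‖ ^ 2) V)
    {S : Ω → ℂ} (hS : ∀ᵐ ω ∂P, HasSum (fun m => a m ω * c m) (S ω)) :
    Integrable (fun ω => (S ω).re ^ 2) P ∧ ∫ ω, (S ω).re ^ 2 ∂P = V / 2 := by
  lift V to NNReal using hc.nonneg fun _ => by positivity
  have hm := aemeasurable_of_series ha hS
  have h := map_re_series ha hindep hc hS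
  have h2 : MemLp id 2 (P.map (fun ω => (S ω).re)) := by
    rw [h]; exact memLp_id_gaussianReal 2
  have h3 : ∫ x, x ^ 2 ∂(P.map (fun ω => (S ω).re)) = V / 2 := by
    have := variance_of_integral_eq_zero (X := fun x : ℝ => x) (μ := gaussianReal 0 (V / 2))
      (by fun_prop) (by simp)
    rw [h, ← this, variance_fun_id_gaussianReal]
    simp
  constructor
  · have := h2.integrable_sq
    exact this.comp_aemeasurable (by fun_prop)
  · rw [← h3, integral_map (by fun_prop) (by apply Measurable.aestronglyMeasurable; fun_prop)]

/-- The imaginary part of `S` is the real part of `-i S`, a series whose coefficients have the same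
moduli, so each part contributes `V / 2`. -/
theorem integral_normSq_series [IsProbabilityMeasure P] (ha : ∀ m, HasLaw (a m) stdComplexGaussian P)
    (hindep : iIndepFun a P) {c : ℕ → ℂ} {V : ℝ} (hc : HasSum (fun m => ‖c m‖ ^ 2) V)
    {S : Ω → ℂ} (hS : ∀ᵐ ω ∂P, HasSum (fun m => a m ω * c m) (S ω)) :
    Integrable (fun ω => ‖S ω‖ ^ 2) P ∧ ∫ ω, ‖S ω‖ ^ 2 ∂P = V := by
  have h1 := integral_re_sq_series ha hindep hc hS
  have h2 := integral_re_sq_series (c := fun m => -I * c m) (S := fun ω => -I * S ω)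
    ha hindep (by simpa using hc) (by
      filter_upwards [hS] with ω h
      convert! h.mul_left (-I) using 2 with m
      ring)
  have e : ∀ ω, ‖S ω‖ ^ 2 = (S ω).re ^ 2 + (-I * S ω).re ^ 2 := by
    intro ω
    rw [← Complex.normSq_eq_norm_sq, Complex.normSq_apply]
    simp
    ring
  simp_rw [e]
  refine ⟨h1.1.add h2.1, ?_⟩
  rw [integral_add h1.1 h2.1, h1.2, h2.2]
  ring

theorem mul_conj_polarization (x y : ℂ) :
    x * conj y = ((‖x + y‖ ^ 2 : ℝ) - (‖x - y‖ ^ 2 : ℝ) + I * (‖x + I * y‖ ^ 2 : ℝ)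
      - I * (‖x - I * y‖ ^ 2 : ℝ)) / 4 := by
  simp only [← Complex.normSq_eq_norm_sq, Complex.normSq_eq_conj_mul_self]
  simp only [map_add, map_sub, map_mul, conj_I]
  linear_combination (x * conj y / 2 - y * conj x / 2) * Complex.I_sq

/-- Polarization: each `S + k T` is again a series in the `a_m`, with coefficients `c_m + k d_m`, so
its second moment is known. -/
theorem integral_mul_conj_series [IsProbabilityMeasure P] (ha : ∀ m, HasLaw (a m) stdComplexGaussian P)
    (hindep : iIndepFun a P) {c d : ℕ → ℂ} (hc : Summable (fun m => ‖c m‖ ^ 2))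
    (hd : Summable (fun m => ‖d m‖ ^ 2))
    {S T : Ω → ℂ} (hS : ∀ᵐ ω ∂P, HasSum (fun m => a m ω * c m) (S ω))
    (hT : ∀ᵐ ω ∂P, HasSum (fun m => a m ω * d m) (T ω)) :
    ∫ ω, S ω * conj (T ω) ∂P = ∑' m, c m * conj (d m) := by
  have hs : ∀ k : ℂ, Summable (fun m => ‖c m + k * d m‖ ^ 2) := by
    intro k
    refine Summable.of_nonneg_of_le (fun _ => by positivity) (fun m => ?_)
      ((hc.mul_left 2).add (hd.mul_left (2 * ‖k‖ ^ 2)))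
    have := norm_add_le (c m) (k * d m)
    rw [norm_mul] at this
    have h2 := pow_le_pow_left₀ (norm_nonneg _) this 2
    nlinarith [sq_nonneg (‖c m‖ - ‖k‖ * ‖d m‖)]
  have key : ∀ k : ℂ, Integrable (fun ω => ‖S ω + k * T ω‖ ^ 2) P ∧
      ∫ ω, ‖S ω + k * T ω‖ ^ 2 ∂P = ∑' m, ‖c m + k * d m‖ ^ 2 := by
    intro k
    refine integral_normSq_series ha hindep (hs k).hasSum ?_
    filter_upwards [hS, hT] with ω h1 h2
    convert! h1.add (h2.mul_left k) using 2 with m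
    ring
  have ci : ∀ {f : Ω → ℝ}, Integrable f P → Integrable (fun ω => (f ω : ℂ)) P :=
    fun h => h.ofReal
  have i1 := ci (key 1).1
  have i2 := ci (key (-1)).1
  have i3 := (ci (key I).1).const_mul I
  have i4 := (ci (key (-I)).1).const_mul I
  have pol : ∀ x y : ℂ, x * conj y = ((‖x + 1 * y‖ ^ 2 : ℝ) - (‖x + -1 * y‖ ^ 2 : ℝ)
      + I * (‖x + I * y‖ ^ 2 : ℝ) - I * (‖x + -I * y‖ ^ 2 : ℝ)) / 4 := by
    intro x y
    rw [mul_conj_polarization]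
    simp only [one_mul, neg_mul, sub_eq_add_neg]
  simp_rw [pol]
  have s1 := (Complex.hasSum_ofReal (L := .unconditional ℕ)).2 (hs 1).hasSum
  have s2 := (Complex.hasSum_ofReal (L := .unconditional ℕ)).2 (hs (-1)).hasSum
  have s3 := ((Complex.hasSum_ofReal (L := .unconditional ℕ)).2 (hs I).hasSum).mul_left I
  have s4 := ((Complex.hasSum_ofReal (L := .unconditional ℕ)).2 (hs (-I)).hasSum).mul_left I
  rw [((((s1.sub s2).add s3).sub s4).div_const 4).tsum_eq, integral_div]
  congr 1
  have lin : ∀ {f g h k : Ω → ℂ}, Integrable f P → Integrable g P → Integrable h P →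
      Integrable k P → ∫ ω, (f ω - g ω + h ω - k ω) ∂P
        = ∫ ω, f ω ∂P - ∫ ω, g ω ∂P + ∫ ω, h ω ∂P - ∫ ω, k ω ∂P := by
    intro f g h k hf hg hh hk
    rw [integral_sub (by exact (hf.sub hg).add hh) hk, integral_add (by exact hf.sub hg) hh,
      integral_sub hf hg]
  rw [lin i1 i2 i3 i4, integral_const_mul, integral_const_mul]
  rw [← (key 1).2, ← (key (-1)).2, ← (key I).2, ← (key (-I)).2]
  simp only [← integral_complex_ofReal]

end

/-! ### Counting zeros in closed disks by Jensen's formula. -/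

theorem zeroMeasure_apply (f : ℂ → ℂ) {B : Set 𝔻} (hB : MeasurableSet B) :
    zeroMeasure f B
      = ∑' z : 𝔻, B.indicator (fun z => ((analyticOrderAt f (z : ℂ) : ℕ∞) : ℝ≥0∞)) z := by
  rw [zeroMeasure, Measure.sum_apply _ hB]
  refine tsum_congr fun z => ?_
  rw [Measure.smul_apply, Measure.dirac_apply' _ hB]
  by_cases h : z ∈ B <;> simp [h]

theorem zeroMeasure_preimage (f : ℂ → ℂ) {K : Set ℂ} (hK : MeasurableSet K)
    (hK1 : K ⊆ Metric.ball 0 1) :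
    zeroMeasure f ((↑) ⁻¹' K : Set 𝔻)
      = ∑' z : ℂ, K.indicator (fun z => ((analyticOrderAt f z : ℕ∞) : ℝ≥0∞)) z := by
  rw [zeroMeasure_apply f (UnitDisc.continuous_coe.measurable hK)]
  refine UnitDisc.coe_injective.tsum_eq (f := K.indicator
    (fun z => ((analyticOrderAt f z : ℕ∞) : ℝ≥0∞))) ?_
  intro z hz
  have hz1 : z ∈ K := Set.mem_of_indicator_ne_zero hz
  exact ⟨UnitDisc.mk z (by simpa using hK1 hz1), rfl⟩

theorem analyticOrderAt_ne_top_of_ball {f : ℂ → ℂ} (hf : AnalyticOnNhd ℂ f (Metric.ball 0 1))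
    (h0 : ∃ z ∈ Metric.ball (0 : ℂ) 1, f z ≠ 0) {z : ℂ} (hz : z ∈ Metric.ball 0 1) :
    analyticOrderAt f z ≠ ⊤ := by
  obtain ⟨w, hw, hfw⟩ := h0
  refine hf.analyticOrderAt_ne_top_of_isPreconnected (convex_ball 0 1).isPreconnected hw hz ?_
  rw [(hf w hw).analyticOrderAt_eq_zero.2 hfw]
  exact ENat.zero_ne_top

theorem closedBall_subset_unitBall {c : ℂ} {R : ℝ} (h : ‖c‖ + R < 1) :
    Metric.closedBall c R ⊆ Metric.ball 0 1 :=
  Metric.closedBall_subset_ball' (by rw [dist_zero_right]; linarith)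

/-- By Jensen's formula the circle average of `log |f|` is `∑ m(u) (log r - log |c - u|)` plus a
constant, over the zeros `u` in the closed disk of radius `r`. For `r` slightly above `R` no new
zero appears, so the average grows by the zero count times `log r - log R`. Zeros on the circle of
radius `R` are included, which is why the increment is taken to the right. Averages of `log |f|`
depend measurably on `f`, unlike the count as defined. -/
theorem exists_zeroCount {f : ℂ → ℂ} (hf : AnalyticOnNhd ℂ f (Metric.ball 0 1))
    (h0 : ∃ z ∈ Metric.ball (0 : ℂ) 1, f z ≠ 0) {c : ℂ} {R : ℝ} (hR : 0 < R) (h : ‖c‖ + R < 1) :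
    ∃ N : ℕ, zeroMeasure f ((↑) ⁻¹' Metric.closedBall c R : Set 𝔻) = N ∧
      ∀ᶠ r in 𝓝[>] R, Real.circleAverage (fun z => Real.log ‖f z‖) c r
        - Real.circleAverage (fun z => Real.log ‖f z‖) c R = N * (Real.log r - Real.log R) := by
  classical
  have htop := fun z hz => analyticOrderAt_ne_top_of_ball hf h0 (z := z) hz
  set m : ℂ → ℕ := fun u => (analyticOrderAt f u).toNat with hm
  have hmc : ∀ z ∈ Metric.ball (0 : ℂ) 1, ((m z : ℕ) : ℕ∞) = analyticOrderAt f z :=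
    fun z hz => ENat.natCast_toNat (htop z hz)
  obtain ⟨ρ, hRρ, hρ⟩ : ∃ ρ, R < ρ ∧ ‖c‖ + ρ < 1 := by
    obtain ⟨ρ, h1, h2⟩ := exists_between (show R < 1 - ‖c‖ by linarith)
    exact ⟨ρ, h1, by linarith⟩
  have hdiv : ∀ r ≤ ρ, ∀ u, MeromorphicOn.divisor f (Metric.closedBall c r) u
      = if u ∈ Metric.closedBall c r then (m u : ℤ) else 0 := by
    intro r hr u
    have hsub := closedBall_subset_unitBall (c := c) (R := r) (by linarith)
    have han := hf.mono hsub
    split_ifs with hu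
    · rw [MeromorphicOn.AnalyticOnNhd.divisor_apply han hu, ← hmc u (hsub hu)]
      rfl
    · exact Function.locallyFinsuppWithin.apply_eq_zero_of_notMem _ hu
  set S := ((MeromorphicOn.divisor f (Metric.closedBall c ρ)).finiteSupport
    (isCompact_closedBall c ρ)).toFinset with hS
  have hmemS : ∀ u, u ∈ S ↔ u ∈ Metric.closedBall c ρ ∧ m u ≠ 0 := by
    intro u
    rw [hS, Set.Finite.mem_toFinset, Function.mem_support, hdiv ρ le_rfl]
    by_cases hu : u ∈ Metric.closedBall c ρ <;> simp [hu]
  set T := S.filter (· ∈ Metric.closedBall c R) with hT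
  have hRρ' := Metric.closedBall_subset_closedBall (x := c) hRρ.le
  -- A zero at the centre contributes `m(c) log r`; the convention `log 0 = 0` lets the same summand
  -- cover `u = c`.
  have hJ : ∀ r, 0 < r → r ≤ ρ → R ≤ r → (∀ u ∈ S, u ∈ Metric.closedBall c r →
      u ∈ Metric.closedBall c R) → Real.circleAverage (fun z => Real.log ‖f z‖) c r
        = ∑ u ∈ T, (m u : ℝ) * (Real.log r - Real.log ‖c - u‖)
          + Real.log ‖meromorphicTrailingCoeffAt f c‖ := by
    intro r hr0 hrρ hRr hno
    have hsub := closedBall_subset_unitBall (c := c) (R := r) (by linarith)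
    have han := (hf.mono hsub).meromorphicOn
    have hJ := MeromorphicOn.circleAverage_log_norm (c := c) (R := r) hr0.ne'
      (by rwa [abs_of_pos hr0])
    rw [abs_of_pos hr0] at hJ
    rw [hJ, ← countingFunction_finsum_eq_finsum_add hr0.ne'
      ((MeromorphicOn.divisor f _).finiteSupport (isCompact_closedBall c r))]
    congr 1
    have hsupp : ∀ u, u ∉ T → MeromorphicOn.divisor f (Metric.closedBall c r) u = 0 := by
      intro u hu
      rw [hdiv r hrρ]
      split_ifs with hur
      · by_contra hne
        have huS : u ∈ S := (hmemS u).2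
          ⟨Metric.closedBall_subset_closedBall hrρ hur, by exact_mod_cast hne⟩
        exact hu (Finset.mem_filter.2 ⟨huS, hno u huS hur⟩)
      · rfl
    rw [finsum_eq_sum_of_support_subset (s := T)]
    · refine Finset.sum_congr rfl fun u hu => ?_
      have : u ∈ Metric.closedBall c r :=
        Metric.closedBall_subset_closedBall hRr (Finset.mem_filter.1 hu).2
      rw [hdiv r hrρ, if_pos this]
      simp
    · intro u hu
      by_contra hne
      apply hu
      simp [hsupp u hne]
  refine ⟨∑ u ∈ T, m u, ?_, ?_⟩
  · rw [zeroMeasure_preimage f Metric.isClosed_closedBall.measurableSet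
      (closedBall_subset_unitBall h), tsum_eq_sum (s := T)]
    · push_cast
      refine Finset.sum_congr rfl fun u hu => ?_
      have hu' := (Finset.mem_filter.1 hu).2
      rw [Set.indicator_of_mem hu', ← hmc u (closedBall_subset_unitBall h hu')]
      simp
    · intro u hu
      by_cases hu' : u ∈ Metric.closedBall c R
      · rw [Set.indicator_of_mem hu', ← hmc u (closedBall_subset_unitBall h hu')]
        by_contra hne
        have hne' : m u ≠ 0 := by
          intro h; rw [h] at hne; simp at hne
        exact hu (Finset.mem_filter.2 ⟨(hmemS u).2 ⟨hRρ' hu', hne'⟩, hu'⟩)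
      · exact Set.indicator_of_notMem hu' _
  -- Only finitely many zeros lie in the disk of radius `ρ`, so those outside the closed disk of
  -- radius `R` stay at a positive distance from it.
  · have e1 : ∀ᶠ r in 𝓝[>] R, ∀ u ∈ S, u ∈ Metric.closedBall c r → u ∈ Metric.closedBall c R := by
      rw [eventually_all_finset]
      intro u _
      by_cases hu : u ∈ Metric.closedBall c R
      · exact Eventually.of_forall fun _ _ => hu
      · rw [Metric.mem_closedBall, not_le] at hu
        filter_upwards [mem_nhdsWithin_of_mem_nhds (Iio_mem_nhds hu)] with r hr hur
        exact absurd (Metric.mem_closedBall.1 hur) (not_le.2 hr)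
    filter_upwards [e1, self_mem_nhdsWithin, mem_nhdsWithin_of_mem_nhds (Iio_mem_nhds hRρ)]
      with r h1 h2 h3
    have h2' : R < r := h2
    rw [hJ r (hR.trans h2') (le_of_lt h3) h2'.le h1,
      hJ R hR hRρ.le le_rfl (fun _ _ h => h)]
    push_cast
    rw [add_sub_add_right_eq_sub, ← Finset.sum_sub_distrib, Finset.sum_mul]
    refine Finset.sum_congr rfl fun u _ => ?_
    ring

theorem zeroMeasure_closedBall_lt_top {f : ℂ → ℂ} (hf : AnalyticOnNhd ℂ f (Metric.ball 0 1))
    (h0 : ∃ z ∈ Metric.ball (0 : ℂ) 1, f z ≠ 0) {c : ℂ} {R : ℝ} (hR : 0 < R) (h : ‖c‖ + R < 1) :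
    zeroMeasure f ((↑) ⁻¹' Metric.closedBall c R : Set 𝔻) < ∞ := by
  obtain ⟨N, hN, -⟩ := exists_zeroCount hf h0 hR h
  rw [hN]
  exact ENNReal.natCast_lt_top N

theorem isLocallyFiniteMeasure_zeroMeasure {f : ℂ → ℂ}
    (hf : AnalyticOnNhd ℂ f (Metric.ball 0 1))
    (h0 : ∃ z ∈ Metric.ball (0 : ℂ) 1, f z ≠ 0) : IsLocallyFiniteMeasure (zeroMeasure f) := by
  refine ⟨fun z => ?_⟩
  have hz := z.norm_lt_one
  have hR : 0 < (1 - ‖(z : ℂ)‖) / 2 := by linarith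
  refine ⟨_, UnitDisc.continuous_coe.continuousAt.preimage_mem_nhds
    (Metric.closedBall_mem_nhds (z : ℂ) hR), ?_⟩
  exact zeroMeasure_closedBall_lt_top hf h0 hR (by linarith)

/-! ### Zeros in open sets through countably many families of disks. -/

instance : SecondCountableTopology 𝔻 := UnitDisc.isEmbedding_coe.secondCountableTopology

instance : T2Space 𝔻 := UnitDisc.isEmbedding_coe.t2Space

instance : Nonempty 𝔻 := ⟨0⟩

/-- A countable family of closed disks with dense centres and arbitrarily small radii. -/
def smallBall (i : ℕ × ℕ) : Set ℂ :=
  Metric.closedBall (TopologicalSpace.denseSeq ℂ i.1) (1 / ((i.2 : ℝ) + 1))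

theorem measurableSet_smallBall (i : ℕ × ℕ) : MeasurableSet ((↑) ⁻¹' smallBall i : Set 𝔻) :=
  UnitDisc.continuous_coe.measurable Metric.isClosed_closedBall.measurableSet

/-- Finite disjoint families of small disks contained in `U`. -/
def IsPacking (U : Set 𝔻) (T : Finset (ℕ × ℕ)) : Prop :=
  (∀ i ∈ T, ‖TopologicalSpace.denseSeq ℂ i.1‖ + 1 / ((i.2 : ℝ) + 1) < 1 ∧
    ((↑) ⁻¹' smallBall i : Set 𝔻) ⊆ U) ∧
  (T : Set (ℕ × ℕ)).PairwiseDisjoint fun i => ((↑) ⁻¹' smallBall i : Set 𝔻)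

theorem exists_packing {U : Set 𝔻} (hU : IsOpen U) (s : Finset 𝔻) (hs : (s : Set 𝔻) ⊆ U) :
    ∃ T, IsPacking U T ∧ (s : Set 𝔻) ⊆ ⋃ i ∈ T, ((↑) ⁻¹' smallBall i : Set 𝔻) := by
  classical
  have e1 : ∀ᶠ ε in 𝓝[>] (0 : ℝ), ∀ z ∈ s, ‖(z : ℂ)‖ + ε < 1 ∧
      (∀ w : 𝔻, dist (w : ℂ) z < ε → w ∈ U) ∧ ∀ w ∈ s, w ≠ z → ε ≤ dist (w : ℂ) z := by
    rw [eventually_all_finset]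
    intro z hz
    refine Eventually.and ?_ (Eventually.and ?_ ?_)
    · have : (0 : ℝ) < 1 - ‖(z : ℂ)‖ := by linarith [z.norm_lt_one]
      filter_upwards [mem_nhdsWithin_of_mem_nhds (Iio_mem_nhds this)] with ε hε
      have : ε < _ := hε
      linarith
    · have h1 : U ∈ 𝓝 z := hU.mem_nhds (hs hz)
      rw [UnitDisc.isEmbedding_coe.isInducing.nhds_eq_comap, mem_comap] at h1
      obtain ⟨V, hV, hVU⟩ := h1
      obtain ⟨δ, hδ, hball⟩ := Metric.mem_nhds_iff.1 hV
      filter_upwards [mem_nhdsWithin_of_mem_nhds (Iio_mem_nhds hδ)] with ε hε w hw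
      exact hVU (hball (hw.trans hε))
    · rw [eventually_all_finset]
      intro w _
      by_cases hwz : w = z
      · exact Eventually.of_forall fun _ h => absurd hwz h
      · have : 0 < dist (w : ℂ) z := dist_pos.2 fun h => hwz (UnitDisc.coe_injective h)
        filter_upwards [mem_nhdsWithin_of_mem_nhds (Iio_mem_nhds this)] with ε hε _
        exact le_of_lt hε
  obtain ⟨ε, he, hε⟩ := (e1.and self_mem_nhdsWithin).exists
  have hε' : 0 < ε := hε
  -- Radius and displacement of the centre are both below `ε / 4`, so each disk lies within `ε / 2`
  -- of its point, whereas distinct points of `s` are at least `ε` apart.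
  obtain ⟨n, hn⟩ := exists_nat_one_div_lt (show 0 < ε / 4 by linarith)
  have hn0 : 0 < 1 / ((n : ℝ) + 1) := by positivity
  have hk : ∀ z : 𝔻, ∃ k, dist (z : ℂ) (TopologicalSpace.denseSeq ℂ k) < 1 / ((n : ℝ) + 1) :=
    fun z => by
      simpa using (TopologicalSpace.denseRange_denseSeq ℂ).exists_dist_lt (z : ℂ) hn0
  choose k hk using hk
  have hsub : ∀ z w : 𝔻, (w : ℂ) ∈ smallBall (k z, n) → dist (w : ℂ) z < ε / 2 := by
    intro z w hw
    have h1 : dist (w : ℂ) _ ≤ 1 / ((n : ℝ) + 1) := hw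
    have h2 := hk z
    have h3 := dist_triangle_right (w : ℂ) z (TopologicalSpace.denseSeq ℂ (k z))
    linarith
  refine ⟨s.image fun z => (k z, n), ⟨?_, ?_⟩, ?_⟩
  · intro i hi
    obtain ⟨z, hz, rfl⟩ := Finset.mem_image.1 hi
    obtain ⟨h1, h2, -⟩ := he z hz
    constructor
    · have := hk z
      have h3 : ‖TopologicalSpace.denseSeq ℂ (k z)‖ ≤ ‖(z : ℂ)‖
          + dist (z : ℂ) (TopologicalSpace.denseSeq ℂ (k z)) := by
        rw [dist_comm, dist_eq_norm]
        exact norm_le_insert' _ _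
      simp only
      linarith
    · intro w hw
      exact h2 w (by linarith [hsub z w hw])
  · intro i hi j hj hij
    obtain ⟨z, hz, rfl⟩ := Finset.mem_image.1 (Finset.mem_coe.1 hi)
    obtain ⟨w, hw, rfl⟩ := Finset.mem_image.1 (Finset.mem_coe.1 hj)
    have hne : w ≠ z := by
      rintro rfl
      exact hij rfl
    have hd := (he z hz).2.2 w hw hne
    refine Set.disjoint_left.2 fun x hx1 hx2 => ?_
    have h1 := hsub z x hx1
    have h2 := hsub w x hx2
    have := dist_triangle_left (w : ℂ) z x
    linarith
  · intro z hz
    rw [Set.mem_iUnion₂]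
    refine ⟨(k z, n), Finset.mem_image_of_mem _ hz, ?_⟩
    exact (hk z).le

/-- The sum over zeros is a supremum over finite sets of points, and each finite subset of `U` is
covered by a packing. The packings form a countable set, so the supremum preserves measurability. -/
theorem zeroMeasure_open (f : ℂ → ℂ) {U : Set 𝔻} (hU : IsOpen U) :
    zeroMeasure f U = ⨆ T : {T // IsPacking U T},
      ∑ i ∈ T.1, zeroMeasure f ((↑) ⁻¹' smallBall i : Set 𝔻) := by
  classical
  apply le_antisymm
  · rw [zeroMeasure_apply f hU.measurableSet, ENNReal.tsum_eq_iSup_sum]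
    refine iSup_le fun s => ?_
    obtain ⟨T, hT, hsT⟩ := exists_packing hU (s.filter (· ∈ U)) (by
      intro z hz
      exact (Finset.mem_filter.1 hz).2)
    refine le_iSup_of_le ⟨T, hT⟩ ?_
    rw [← measure_biUnion_finset hT.2 (fun i _ => measurableSet_smallBall i)]
    refine le_trans ?_ (measure_mono hsT)
    rw [zeroMeasure_apply f (Finset.measurableSet _)]
    refine le_trans (Finset.sum_le_sum fun z hz => ?_) (ENNReal.sum_le_tsum s)
    by_cases h : z ∈ U
    · rw [Set.indicator_of_mem h, Set.indicator_of_mem (by simp [hz, h])]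
    · rw [Set.indicator_of_notMem h]
      exact zero_le
  · refine iSup_le fun T => ?_
    rw [← measure_biUnion_finset T.2.2 (fun i _ => measurableSet_smallBall i)]
    exact measure_mono (Set.iUnion₂_subset fun i hi => (T.2.1 i hi).2)

/-! ### Measurability of the zero measure. -/

section

variable {X : Type*} [MeasurableSpace X] {F : X → ℂ → ℂ}

/-- The values on the circle are continuous in the angle and measurable in `x`, hence jointly
measurable, so the integral over the angle is measurable in `x`. -/
theorem measurable_circleAverage_log (hF : ∀ x, AnalyticOnNhd ℂ (F x) (Metric.ball 0 1))
    (hmeas : ∀ z ∈ Metric.ball (0 : ℂ) 1, Measurable fun x => F x z)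
    {c : ℂ} {R : ℝ} (hR : 0 < R) (h : ‖c‖ + R < 1) :
    Measurable fun x => Real.circleAverage (fun z => Real.log ‖F x z‖) c R := by
  have hmem : ∀ θ, circleMap c R θ ∈ Metric.ball (0 : ℂ) 1 := fun θ =>
    closedBall_subset_unitBall h (circleMap_mem_closedBall c hR.le θ)
  have h1 : Measurable (Function.uncurry fun (θ : ℝ) (x : X) => F x (circleMap c R θ)) := by
    refine measurable_uncurry_of_continuous_of_measurable (fun x => ?_) (fun θ => hmeas _ (hmem θ))
    exact (hF x).continuousOn.comp_continuous (continuous_circleMap c R) hmem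
  have h2 : Measurable (fun p : X × ℝ => Real.log ‖F p.1 (circleMap c R p.2)‖) :=
    Real.measurable_log.comp (measurable_norm.comp (h1.comp measurable_swap))
  simp only [Real.circleAverage_def, intervalIntegral.integral_of_le Real.two_pi_pos.le]
  have h3 := (h2.stronglyMeasurable.integral_prod_right'
    (ν := volume.restrict (Set.Ioc 0 (2 * Real.pi)))).measurable
  exact h3.const_mul _

theorem measurable_zeroMeasure_closedBall
    (hF : ∀ x, AnalyticOnNhd ℂ (F x) (Metric.ball 0 1))
    (h0 : ∀ x, ∃ z ∈ Metric.ball (0 : ℂ) 1, F x z ≠ 0)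
    (hmeas : ∀ z ∈ Metric.ball (0 : ℂ) 1, Measurable fun x => F x z)
    {c : ℂ} {R : ℝ} (hR : 0 < R) (h : ‖c‖ + R < 1) :
    Measurable fun x => zeroMeasure (F x) ((↑) ⁻¹' Metric.closedBall c R : Set 𝔻) := by
  obtain ⟨r, hr1, hr2, hr3⟩ := exists_seq_strictAnti_tendsto' (show R < 1 - ‖c‖ by linarith)
  have hr2' : ∀ n, 0 < r n := fun n => hR.trans (hr2 n).1
  -- For each `x` these difference quotients eventually equal the zero count.
  refine measurable_of_tendsto_metrizable (f := fun n x => ENNReal.ofReal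
    ((Real.circleAverage (fun z => Real.log ‖F x z‖) c (r n)
      - Real.circleAverage (fun z => Real.log ‖F x z‖) c R) / (Real.log (r n) - Real.log R)))
    (fun n => ?_) (tendsto_pi_nhds.2 fun x => ?_)
  · have m1 := measurable_circleAverage_log hF hmeas hR h
    have m2 := measurable_circleAverage_log hF hmeas (hr2' n)
      (show ‖c‖ + r n < 1 by linarith [(hr2 n).2])
    exact ENNReal.measurable_ofReal.comp ((m2.sub m1).div_const _)
  · obtain ⟨N, hN, hev⟩ := exists_zeroCount (hF x) (h0 x) hR h
    have ht : Tendsto r atTop (𝓝[>] R) :=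
      tendsto_nhdsWithin_iff.2 ⟨hr3, Eventually.of_forall fun n => (hr2 n).1⟩
    refine tendsto_const_nhds.congr' ?_
    filter_upwards [ht.eventually hev] with n hn
    have : Real.log (r n) - Real.log R ≠ 0 :=
      (sub_pos.2 (Real.log_lt_log hR (hr2 n).1)).ne'
    rw [hn, hN, mul_div_cancel_right₀ _ this, ENNReal.ofReal_natCast]

theorem measurable_zeroMeasure (hF : ∀ x, AnalyticOnNhd ℂ (F x) (Metric.ball 0 1))
    (h0 : ∀ x, ∃ z ∈ Metric.ball (0 : ℂ) 1, F x z ≠ 0)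
    (hmeas : ∀ z ∈ Metric.ball (0 : ℂ) 1, Measurable fun x => F x z) :
    Measurable fun x => zeroMeasure (F x) := by
  have hopen : ∀ U : Set 𝔻, IsOpen U → Measurable fun x => zeroMeasure (F x) U := by
    intro U hU
    simp_rw [zeroMeasure_open _ hU]
    refine Measurable.iSup fun T => Finset.measurable_sum _ fun i hi => ?_
    exact measurable_zeroMeasure_closedBall hF h0 hmeas (by positivity) (T.2.1 i hi).1
  obtain ⟨r, hr1, hr2, hr3⟩ := exists_seq_strictMono_tendsto' (zero_lt_one (α := ℝ))
  -- The π-system argument needs finite measures, while the disk may contain infinitely many zeros;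
  -- hence the restriction to smaller disks exhausting it.
  set D : ℕ → Set 𝔻 := fun n => (↑) ⁻¹' Metric.ball (0 : ℂ) (r n) with hD
  have hDo : ∀ n, IsOpen (D n) := fun n => Metric.isOpen_ball.preimage UnitDisc.continuous_coe
  have hfin : ∀ n x, IsFiniteMeasure ((zeroMeasure (F x)).restrict (D n)) := by
    intro n x
    refine ⟨?_⟩
    rw [Measure.restrict_apply_univ]
    exact (measure_mono (Set.preimage_mono Metric.ball_subset_closedBall)).trans_lt
      (zeroMeasure_closedBall_lt_top (hF x) (h0 x) (hr2 n).1 (by simpa using (hr2 n).2))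
  have hrestr : ∀ n, Measurable fun x => (zeroMeasure (F x)).restrict (D n) := by
    intro n
    refine Measurable.measure_of_isPiSystem (BorelSpace.measurable_eq.trans rfl)
      isPiSystem_isOpen (fun U hU => ?_) ?_
    · have hU' : IsOpen U := hU
      simp_rw [Measure.restrict_apply hU'.measurableSet]
      exact hopen _ (hU'.inter (hDo n))
    · simp_rw [Measure.restrict_apply_univ]
      exact hopen _ (hDo n)
  refine Measure.measurable_of_measurable_coe _ fun B hB => ?_
  have hmono : Monotone D := fun i j hij =>
    Set.preimage_mono (Metric.ball_subset_ball (hr1.monotone hij))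
  have hcov : ⋃ n, D n = Set.univ := by
    refine Set.eq_univ_of_forall fun z => Set.mem_iUnion.2 ?_
    obtain ⟨n, hn⟩ := (hr3.eventually (lt_mem_nhds z.norm_lt_one)).exists
    exact ⟨n, by simpa [hD] using hn⟩
  have : ∀ x, zeroMeasure (F x) B = ⨆ n, (zeroMeasure (F x)).restrict (D n) B := by
    intro x
    simp_rw [Measure.restrict_apply hB]
    rw [← (show Monotone fun n => B ∩ D n from fun i j hij =>
      Set.inter_subset_inter_right _ (hmono hij)).measure_iUnion, ← Set.inter_iUnion, hcov,
      Set.inter_univ]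
  simp_rw [this]
  exact Measurable.iSup fun n => (Measure.measurable_coe hB).comp (hrestr n)

end

/-! ### Transfer of equality in law from values to zeros. -/

/-- With `S` given the σ-algebra pulled back by `e`, equality in law of `e ∘ X` and `e ∘ Y` is
equality in law of `X` and `Y` themselves. -/
theorem identDistrib_comp_of_comap {Ω S V M : Type*} [MeasurableSpace Ω] {P : Measure Ω}
    [Nonempty S] [mV : MeasurableSpace V] [MeasurableSpace M] (e : S → V) {X Y : Ω → S}
    (h : IdentDistrib (fun ω => e (X ω)) (fun ω => e (Y ω)) P P) {H : S → M}
    (hH : Measurable[mV.comap e] H) :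
    IdentDistrib (fun ω => H (X ω)) (fun ω => H (Y ω)) P P := by
  classical
  let _ : MeasurableSpace S := mV.comap e
  have key : ∀ {X : Ω → S}, AEMeasurable (fun ω => e (X ω)) P → AEMeasurable X P := by
    intro X hX
    -- The measurable version of `e ∘ X` may leave the range of `e`; `X` is therefore replaced by a
    -- constant on a measurable null set containing every point of disagreement.
    obtain ⟨t, hst, htm, ht0⟩ := exists_measurable_superset_of_null
      (ae_iff.1 hX.ae_eq_mk)
    set A := tᶜ
    have hAm : MeasurableSet A := htm.compl
    have hA : ∀ ω ∈ A, e (X ω) = hX.mk _ ω := fun ω hω => by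
      by_contra h
      exact hω (hst h)
    have hAP : ∀ᵐ ω ∂P, ω ∈ A := compl_mem_ae_iff.2 ht0
    refine ⟨A.piecewise X fun _ => Classical.arbitrary S, ?_, ?_⟩
    · rw [measurable_comap_iff]
      have : e ∘ A.piecewise X (fun _ => Classical.arbitrary S)
          = A.piecewise (hX.mk _) fun _ => e (Classical.arbitrary S) := by
        ext ω
        by_cases hω : ω ∈ A
        · simpa [hω] using hA ω hω
        · simp [hω]
      rw [this]
      exact hX.measurable_mk.piecewise hAm measurable_const
    · filter_upwards [hAP] with ω hω
      simp [hω]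
  have hX := key h.aemeasurable_fst
  have hY := key h.aemeasurable_snd
  have hXY : IdentDistrib X Y P P := by
    refine ⟨hX, hY, ?_⟩
    ext t ht
    obtain ⟨T, hT, rfl⟩ := ht
    have hm : MeasurableSet (e ⁻¹' T) := ⟨T, hT, rfl⟩
    rw [Measure.map_apply_of_aemeasurable hX hm, Measure.map_apply_of_aemeasurable hY hm]
    exact h.measure_mem_eq hT
  exact hXY.comp hH

/-- Analytic functions on the unit disk which do not vanish identically. -/
def IsNonzeroAnalytic (f : ℂ → ℂ) : Prop :=
  AnalyticOnNhd ℂ f (Metric.ball 0 1) ∧ ∃ z ∈ Metric.ball (0 : ℂ) 1, f z ≠ 0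

/-- The values of `f` along a dense sequence of points in the disk. -/
def denseValues (f : ℂ → ℂ) (n : ℕ) : ℂ := f (TopologicalSpace.denseSeq 𝔻 n)

/-- By continuity, the value at any point of the disk is a limit of values along the dense sequence.
-/
theorem measurable_zeroMeasure_comap :
    Measurable[(inferInstance : MeasurableSpace (ℕ → ℂ)).comap
      fun f : {f // IsNonzeroAnalytic f} => denseValues f.1] fun f : {f // IsNonzeroAnalytic f} =>
        zeroMeasure f.1 := by
  let _ : MeasurableSpace {f // IsNonzeroAnalytic f} :=
    (inferInstance : MeasurableSpace (ℕ → ℂ)).comap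
      fun f : {f // IsNonzeroAnalytic f} => denseValues f.1
  refine measurable_zeroMeasure (F := fun f : {f // IsNonzeroAnalytic f} => f.1)
    (fun f => f.2.1) (fun f => f.2.2) fun z hz => ?_
  have h1 : ∀ n, Measurable fun f : {f // IsNonzeroAnalytic f} =>
      f.1 (TopologicalSpace.denseSeq 𝔻 n) := fun n =>
    (measurable_pi_apply n).comp (comap_measurable fun f : {f // IsNonzeroAnalytic f} =>
      denseValues f.1)
  lift z to 𝔻 using by simpa using hz
  obtain ⟨u, hu, hlim⟩ := mem_closure_iff_seq_limit.1 (TopologicalSpace.denseRange_denseSeq 𝔻 z)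
  choose k hk using hu
  refine measurable_of_tendsto_metrizable (f := fun n (f : {f // IsNonzeroAnalytic f}) =>
    f.1 (TopologicalSpace.denseSeq 𝔻 (k n))) (fun n => h1 (k n)) (tendsto_pi_nhds.2 fun f => ?_)
  simp_rw [hk]
  exact (f.2.1 z hz).continuousAt.tendsto.comp
    ((UnitDisc.continuous_coe.tendsto z).comp hlim)

theorem identDistrib_zeroMeasure {Ω : Type*} [MeasurableSpace Ω] {P : Measure Ω}
    {f g : Ω → ℂ → ℂ} (hf : ∀ᵐ ω ∂P, IsNonzeroAnalytic (f ω))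
    (hg : ∀ᵐ ω ∂P, IsNonzeroAnalytic (g ω))
    (h : IdentDistrib (fun ω => denseValues (f ω)) (fun ω => denseValues (g ω)) P P) :
    IdentDistrib (fun ω => zeroMeasure (f ω)) (fun ω => zeroMeasure (g ω)) P P := by
  classical
  -- Default value on the null set where the random function fails to be analytic and nonzero.
  let one : {f // IsNonzeroAnalytic f} :=
    ⟨fun _ => 1, analyticOnNhd_const, 0, by simp, one_ne_zero⟩
  have : Nonempty {f // IsNonzeroAnalytic f} := ⟨one⟩
  have key : ∀ {f : Ω → ℂ → ℂ}, (∀ᵐ ω ∂P, IsNonzeroAnalytic (f ω)) →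
      ∃ F : Ω → {f // IsNonzeroAnalytic f}, ∀ᵐ ω ∂P, (F ω).1 = f ω := by
    intro f hf
    refine ⟨fun ω => if h : IsNonzeroAnalytic (f ω) then ⟨f ω, h⟩ else one, ?_⟩
    filter_upwards [hf] with ω h
    simp [h]
  obtain ⟨F, hF⟩ := key hf
  obtain ⟨G, hG⟩ := key hg
  have e1 : (fun ω => denseValues (f ω)) =ᵐ[P] fun ω => denseValues (F ω).1 :=
    hF.mono fun ω h => by simp only [h]
  have e2 : (fun ω => denseValues (g ω)) =ᵐ[P] fun ω => denseValues (G ω).1 :=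
    hG.mono fun ω h => by simp only [h]
  have h' : IdentDistrib (fun ω => denseValues (F ω).1) (fun ω => denseValues (G ω).1) P P :=
    ((IdentDistrib.of_ae_eq h.aemeasurable_fst e1).symm.trans h).trans
      (IdentDistrib.of_ae_eq h.aemeasurable_snd e2)
  have h2 := identDistrib_comp_of_comap (fun f : {f // IsNonzeroAnalytic f} => denseValues f.1)
    h' measurable_zeroMeasure_comap
  have e3 : (fun ω => zeroMeasure (F ω).1) =ᵐ[P] fun ω => zeroMeasure (f ω) :=
    hF.mono fun ω h => by simp only [h]
  have e4 : (fun ω => zeroMeasure (G ω).1) =ᵐ[P] fun ω => zeroMeasure (g ω) :=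
    hG.mono fun ω h => by simp only [h]
  exact ((IdentDistrib.of_ae_eq h2.aemeasurable_fst e3).symm.trans h2).trans
    (IdentDistrib.of_ae_eq h2.aemeasurable_snd e4)

/-! ### The weighted Möbius pull-back and its zeros. -/

namespace SU11

theorem continuous_smul (A : SU11) : Continuous fun z : 𝔻 => A • z := by
  rw [UnitDisc.isEmbedding_coe.continuous_iff]
  have h := fun z => den_ne_zero A z
  have : ((↑) : 𝔻 → ℂ) ∘ (fun z : 𝔻 => A • z)
      = fun z : 𝔻 => mobNum A.1.1 z / mobDen A.1.1 z := rfl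
  rw [this]
  have hc := UnitDisc.continuous_coe
  refine Continuous.div ?_ ?_ h
  · unfold mobNum; fun_prop
  · unfold mobDen; fun_prop

/-- The invariant form evaluated at the vectors `(z, 1)` and `(w, 1)`. -/
theorem den_mul_conj_sub (A : SU11) (z w : ℂ) :
    mobDen A.1.1 z * conj (mobDen A.1.1 w) - mobNum A.1.1 z * conj (mobNum A.1.1 w)
      = 1 - z * conj w := by
  have hA : (A.1.1)ᴴ * formJ * A.1.1 = formJ := A.2
  have h00 := congrFun (congrFun hA 0) 0
  have h01 := congrFun (congrFun hA 0) 1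
  have h10 := congrFun (congrFun hA 1) 0
  have h11 := congrFun (congrFun hA 1) 1
  simp [formJ, Matrix.mul_apply, Fin.sum_univ_two] at h00 h01 h10 h11
  simp only [mobNum, mobDen, map_add, map_mul]
  linear_combination -(conj w * z) * h00 - conj w * h01 - z * h10 - h11

/-- The weighted pull-back `z ↦ (c z + d)^{-L} f (A z)` of a function on the disk. -/
def pullback (A : SU11) (L : ℕ) (f : ℂ → ℂ) (z : ℂ) : ℂ :=
  (mobDen A.1.1 z)⁻¹ ^ L * f (mobNum A.1.1 z / mobDen A.1.1 z)

theorem pullback_coe (A : SU11) (L : ℕ) (f : ℂ → ℂ) (z : 𝔻) :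
    pullback A L f z = (mobDen A.1.1 z)⁻¹ ^ L * f (A • z : 𝔻) := rfl

theorem analyticAt_mobius (A : SU11) (z : 𝔻) :
    AnalyticAt ℂ (fun z => mobNum A.1.1 z / mobDen A.1.1 z) z := by
  refine AnalyticAt.div ?_ ?_ (den_ne_zero A z)
  · unfold mobNum; fun_prop
  · unfold mobDen; fun_prop

theorem analyticAt_weight (A : SU11) (L : ℕ) (z : 𝔻) :
    AnalyticAt ℂ (fun z => (mobDen A.1.1 z)⁻¹ ^ L) z := by
  refine AnalyticAt.pow (AnalyticAt.inv ?_ (den_ne_zero A z)) L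
  unfold mobDen; fun_prop

/-- The derivative is `(a d - b c) / (c z + d)²`, with numerator the determinant `1`. -/
theorem deriv_mobius_ne_zero (A : SU11) (z : 𝔻) :
    deriv (fun z => mobNum A.1.1 z / mobDen A.1.1 z) z ≠ 0 := by
  have hd := den_ne_zero A z
  have h1 : HasDerivAt (mobNum A.1.1) (A.1.1 0 0) z := by
    unfold mobNum
    simpa using ((hasDerivAt_id (z : ℂ)).const_mul (A.1.1 0 0)).add_const (A.1.1 0 1)
  have h2 : HasDerivAt (mobDen A.1.1) (A.1.1 1 0) z := by
    unfold mobDen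
    simpa using ((hasDerivAt_id (z : ℂ)).const_mul (A.1.1 1 0)).add_const (A.1.1 1 1)
  rw [(h1.fun_div h2 hd).deriv]
  have hdet : A.1.1 0 0 * A.1.1 1 1 - A.1.1 0 1 * A.1.1 1 0 = 1 := by
    rw [← Matrix.det_fin_two]; exact A.1.2
  have : A.1.1 0 0 * mobDen A.1.1 z - mobNum A.1.1 z * A.1.1 1 0 = 1 := by
    unfold mobDen mobNum
    linear_combination hdet
  rw [this]
  exact div_ne_zero one_ne_zero (pow_ne_zero 2 hd)

theorem analyticAt_pullback (A : SU11) (L : ℕ) {f : ℂ → ℂ} {z : 𝔻}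
    (hf : AnalyticAt ℂ f (A • z : 𝔻)) : AnalyticAt ℂ (pullback A L f) z :=
  (analyticAt_weight A L z).mul
    (AnalyticAt.comp (g := f) (x := (z : ℂ)) hf (analyticAt_mobius A z))

/-- The weight does not vanish, and composition with a locally injective analytic map preserves the
order. -/
theorem analyticOrderAt_pullback (A : SU11) (L : ℕ) {f : ℂ → ℂ} {z : 𝔻}
    (hf : AnalyticAt ℂ f (A • z : 𝔻)) :
    analyticOrderAt (pullback A L f) z = analyticOrderAt f (A • z : 𝔻) := by
  have h1 := analyticAt_weight A L z
  have h2 : AnalyticAt ℂ (f ∘ fun z => mobNum A.1.1 z / mobDen A.1.1 z) z :=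
    AnalyticAt.comp (x := (z : ℂ)) hf (analyticAt_mobius A z)
  have h3 := analyticOrderAt_mul h1 h2
  rw [h1.analyticOrderAt_eq_zero.2 (pow_ne_zero L (inv_ne_zero (den_ne_zero A z))), zero_add,
    analyticOrderAt_comp_of_deriv_ne_zero (analyticAt_mobius A z) (deriv_mobius_ne_zero A z)] at h3
  exact h3

theorem isNonzeroAnalytic_pullback (A : SU11) (L : ℕ) {f : ℂ → ℂ} (hf : IsNonzeroAnalytic f) :
    IsNonzeroAnalytic (pullback A L f) := by
  obtain ⟨h1, w, hw, hfw⟩ := hf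
  constructor
  · intro z hz
    lift z to 𝔻 using by simpa using hz
    exact analyticAt_pullback A L (h1 _ (by simpa using (A • z).norm_lt_one))
  · lift w to 𝔻 using by simpa using hw
    refine ⟨((A⁻¹ • w : 𝔻) : ℂ), by simpa using (A⁻¹ • w).norm_lt_one, ?_⟩
    rw [pullback_coe, smul_inv_smul]
    exact mul_ne_zero (pow_ne_zero L (inv_ne_zero (den_ne_zero A _))) hfw

theorem map_zeroMeasure_pullback (A : SU11) (L : ℕ) {f : ℂ → ℂ}
    (hf : AnalyticOnNhd ℂ f (Metric.ball 0 1)) :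
    (zeroMeasure (pullback A L f)).map (fun z : 𝔻 => A • z) = zeroMeasure f := by
  ext B hB
  have hm := (continuous_smul A).measurable
  rw [Measure.map_apply hm hB, zeroMeasure_apply _ (hm hB), zeroMeasure_apply _ hB]
  refine Eq.trans (tsum_congr fun z => ?_) ((MulAction.toPerm A : Equiv.Perm 𝔻).tsum_eq _)
  have := analyticOrderAt_pullback A L (z := z) (hf _ (by simpa using (A • z).norm_lt_one))
  simp only [Set.indicator, Set.mem_preimage, MulAction.toPerm_apply, this]
  rfl

end SU11

/-! ### Convergence of the random series and its covariance kernel. -/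

theorem choose_add_sub_one {L : ℕ} (hL : 1 ≤ L) (m : ℕ) :
    (m + L - 1).choose m = (m + (L - 1)).choose (L - 1) := by
  rw [Nat.add_sub_assoc hL, Nat.choose_symm_add]

/-- The deterministic coefficients `√(C(m+L-1, m)) z^m` of the `SU(1,1)` random series. -/
def su11Coef (L : ℕ) (z : ℂ) (m : ℕ) : ℂ := (Real.sqrt ((m + L - 1).choose m : ℝ) : ℂ) * z ^ m

theorem su11Term_eq (L : ℕ) (a : ℕ → ℂ) (z : ℂ) (m : ℕ) :
    su11Term L a z m = a m * su11Coef L z m := by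
  unfold su11Term su11Coef
  ring

theorem summable_norm_su11Coef {L : ℕ} (hL : 1 ≤ L) {z : ℂ} (hz : ‖z‖ < 1) :
    Summable fun m => ‖su11Coef L z m‖ := by
  have h := summable_choose_mul_geometric_of_norm_lt_one (L - 1) (r := ‖z‖) (by simpa using hz)
  refine Summable.of_nonneg_of_le (fun _ => norm_nonneg _) (fun m => ?_) h
  rw [su11Coef, norm_mul, norm_pow, Complex.norm_real, Real.norm_of_nonneg (Real.sqrt_nonneg _),
    ← choose_add_sub_one hL]
  refine mul_le_mul_of_nonneg_right ?_ (by positivity)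
  -- A natural number dominates its square root, so the negative binomial series is a majorant.
  rw [Real.sqrt_le_left (by positivity)]
  exact_mod_cast Nat.le_self_pow two_ne_zero _

/-- The square roots multiply to the binomial coefficient, leaving the negative binomial series at
`z conj w`. -/
theorem hasSum_su11Coef_mul_conj {L : ℕ} (hL : 1 ≤ L) (z w : 𝔻) :
    HasSum (fun m => su11Coef L z m * conj (su11Coef L w m))
      (1 / (1 - (z : ℂ) * conj (w : ℂ)) ^ L) := by
  have hzw : ‖(z : ℂ) * conj (w : ℂ)‖ < 1 := by
    rw [norm_mul, RCLike.norm_conj]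
    exact mul_lt_one_of_nonneg_of_lt_one_left (norm_nonneg _) z.norm_lt_one w.norm_lt_one.le
  have h := hasSum_choose_mul_geometric_of_norm_lt_one (L - 1) hzw
  rw [Nat.sub_add_cancel hL] at h
  convert! h using 2 with m
  rw [← choose_add_sub_one hL, su11Coef, su11Coef, map_mul, map_pow, conj_ofReal, mul_pow]
  have : ((Real.sqrt ((m + L - 1).choose m : ℝ) : ℂ)) * (Real.sqrt ((m + L - 1).choose m : ℝ) : ℂ)
      = ((m + L - 1).choose m : ℂ) := by
    rw [← Complex.ofReal_mul, Real.mul_self_sqrt (by positivity)]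
    simp
  linear_combination (z : ℂ) ^ m * conj (w : ℂ) ^ m * this

theorem summable_norm_sq_su11Coef {L : ℕ} (hL : 1 ≤ L) (z : 𝔻) :
    Summable fun m => ‖su11Coef L z m‖ ^ 2 := by
  rw [← Complex.summable_ofReal (L := .unconditional ℕ)]
  convert! (hasSum_su11Coef_mul_conj hL z z).summable using 2 with m
  rw [Complex.mul_conj, Complex.normSq_eq_norm_sq]

/-- The random series converges absolutely in the whole disk and has nonzero constant term. -/
def IsGoodSequence (L : ℕ) (a : ℕ → ℂ) : Prop :=
  (∀ z : 𝔻, Summable fun m => ‖su11Term L a z m‖) ∧ a 0 ≠ 0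

/-- Absolute convergence at a radius `r` dominates the series on `|z| < r`, so the sum is
holomorphic there; its value at `0` is a nonzero multiple of `a 0`. -/
theorem IsGoodSequence.isNonzeroAnalytic {L : ℕ} {a : ℕ → ℂ} (h : IsGoodSequence L a) :
    IsNonzeroAnalytic (su11Fun L a) := by
  constructor
  · refine DifferentiableOn.analyticOnNhd (fun z hz => ?_) Metric.isOpen_ball
    rw [mem_ball_zero_iff] at hz
    obtain ⟨r, hr1, hr2⟩ := exists_between hz
    have hr0 : 0 ≤ r := (norm_nonneg z).trans hr1.le
    have hs := h.1 (UnitDisc.mk r (by rwa [Complex.norm_real, Real.norm_of_nonneg hr0]))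
    have hd : DifferentiableOn ℂ (su11Fun L a) (Metric.ball 0 r) := by
      refine differentiableOn_tsum_of_summable_norm (F := fun m z => su11Term L a z m) hs
        (fun m => ?_) Metric.isOpen_ball fun m w hw => ?_
      · unfold su11Term; fun_prop
      · unfold su11Term
        simp only [norm_mul, norm_pow]
        gcongr
        rw [UnitDisc.coe_mk, Complex.norm_real, Real.norm_of_nonneg hr0]
        exact (mem_ball_zero_iff.1 hw).le
    exact (hd.differentiableAt (Metric.isOpen_ball.mem_nhds
      (mem_ball_zero_iff.2 hr1))).differentiableWithinAt
  · refine ⟨0, by simp, ?_⟩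
    rw [su11Fun, tsum_eq_single 0 (fun m hm => by simp [su11Term, hm])]
    simpa [su11Term] using h.2

section

variable {Ω : Type*} [MeasurableSpace Ω] {P : Measure Ω} {a : ℕ → Ω → ℂ}

theorem lintegral_enorm_le_two [IsProbabilityMeasure P]
    (ha : ∀ m, HasLaw (a m) stdComplexGaussian P) (hindep : iIndepFun a P) (k : ℕ) :
    ∫⁻ ω, ‖a k ω‖ₑ ∂P ≤ 2 := by
  obtain ⟨h1, h2⟩ := integral_normSq_series ha hindep (c := Pi.single k 1) (V := 1) (S := a k)
    (by
      have h := hasSum_single (f := fun m => ‖(Pi.single k 1 : ℕ → ℂ) m‖ ^ 2) k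
        (fun m hm => by simp [hm])
      rwa [Pi.single_eq_same, norm_one, one_pow] at h)
    (Eventually.of_forall fun ω => by
      simpa using hasSum_single (f := fun m => a m ω * (Pi.single k 1 : ℕ → ℂ) m) k
        (fun m hm => by simp [hm]))
  have h3 : Integrable (fun ω => 1 + ‖a k ω‖ ^ 2) P := (integrable_const 1).add h1
  calc ∫⁻ ω, ‖a k ω‖ₑ ∂P ≤ ∫⁻ ω, ENNReal.ofReal (1 + ‖a k ω‖ ^ 2) ∂P := by
        refine lintegral_mono fun ω => ?_
        rw [← ofReal_norm]
        refine ENNReal.ofReal_le_ofReal ?_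
        -- This is `x ≤ 1 + x²`; the right-hand side has expectation `2`.
        nlinarith [sq_nonneg (‖a k ω‖ - 1)]
    _ = ENNReal.ofReal (∫ ω, (1 + ‖a k ω‖ ^ 2) ∂P) :=
        (ofReal_integral_eq_lintegral_ofReal h3 (Eventually.of_forall fun ω => by positivity)).symm
    _ = 2 := by
        rw [integral_add (integrable_const 1) h1, h2]
        norm_num

/-- By Tonelli the expected sum of the moduli is at most twice `∑ ‖su11Coef L z m‖`. -/
theorem ae_summable_su11Term [IsProbabilityMeasure P] {L : ℕ} (hL : 1 ≤ L)
    (ha : ∀ m, HasLaw (a m) stdComplexGaussian P) (hindep : iIndepFun a P) (z : 𝔻) :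
    ∀ᵐ ω ∂P, Summable fun m => ‖su11Term L (fun m => a m ω) z m‖ := by
  have hm := fun m => (ha m).aemeasurable
  have hfin : ∫⁻ ω, ∑' m, ‖su11Term L (fun m => a m ω) z m‖ₑ ∂P ≠ ∞ := by
    simp_rw [su11Term_eq, enorm_mul]
    rw [lintegral_tsum fun m => by fun_prop]
    have h1 : ∑' m, ‖su11Coef L z m‖ₑ ≠ ∞ :=
      ENNReal.tsum_coe_ne_top_iff_summable.2
        (NNReal.summable_coe.1 (summable_norm_su11Coef hL z.norm_lt_one))
    refine ne_top_of_le_ne_top (ENNReal.mul_ne_top ENNReal.ofNat_ne_top h1 : 2 * _ ≠ ∞) ?_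
    rw [← ENNReal.tsum_mul_left]
    refine ENNReal.tsum_le_tsum fun m => ?_
    rw [lintegral_mul_const'' _ (by fun_prop)]
    exact mul_le_mul_left (lintegral_enorm_le_two ha hindep m) _
  have hmeas : AEMeasurable (fun ω => ∑' m, ‖su11Term L (fun m => a m ω) z m‖ₑ) P := by
    simp_rw [su11Term_eq]
    exact AEMeasurable.tsum fun m => by fun_prop
  filter_upwards [ae_lt_top' hmeas hfin] with ω hω
  exact NNReal.summable_coe.2 (ENNReal.tsum_coe_ne_top_iff_summable.1 hω.ne)

/-- Radii increasing to `1` reduce the uncountably many points to countably many null sets; `a 0 ≠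
0` since the Gaussian law gives the origin no mass. -/
theorem ae_isGoodSequence [IsProbabilityMeasure P] {L : ℕ} (hL : 1 ≤ L)
    (ha : ∀ m, HasLaw (a m) stdComplexGaussian P) (hindep : iIndepFun a P) :
    ∀ᵐ ω ∂P, IsGoodSequence L fun m => a m ω := by
  obtain ⟨r, -, hr2, hr3⟩ := exists_seq_strictMono_tendsto' (zero_lt_one (α := ℝ))
  have hr : ∀ n, ‖(r n : ℂ)‖ = r n := fun n => by
    rw [Complex.norm_real, Real.norm_of_nonneg (hr2 n).1.le]
  have h0 : ∀ᵐ ω ∂P, a 0 ω ≠ 0 := by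
    refine ae_of_ae_map (p := fun z => z ≠ 0) (ha 0).aemeasurable ?_
    rw [(ha 0).map_eq, ae_iff]
    simpa using stdComplexGaussian_singleton_zero
  have h1 := ae_all_iff.2 fun n =>
    ae_summable_su11Term hL ha hindep (UnitDisc.mk (r n) (by rw [hr]; exact (hr2 n).2))
  filter_upwards [h0, h1] with ω h0 h1
  refine ⟨fun z => ?_, h0⟩
  obtain ⟨n, hn⟩ := (hr3.eventually (lt_mem_nhds z.norm_lt_one)).exists
  refine Summable.of_nonneg_of_le (fun _ => norm_nonneg _) (fun m => ?_) (h1 n)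
  unfold su11Term
  simp only [norm_mul, norm_pow]
  gcongr
  rw [UnitDisc.coe_mk, hr]
  exact hn.le

theorem ae_hasSum_su11Fun [IsProbabilityMeasure P] {L : ℕ} (hL : 1 ≤ L)
    (ha : ∀ m, HasLaw (a m) stdComplexGaussian P) (hindep : iIndepFun a P) (z : 𝔻) :
    ∀ᵐ ω ∂P, HasSum (fun m => a m ω * su11Coef L z m) (su11Fun L (fun m => a m ω) z) := by
  filter_upwards [ae_summable_su11Term hL ha hindep z] with ω h
  simp_rw [← su11Term_eq L (fun m => a m ω)]
  exact h.of_norm.hasSum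

/-! ### Finite-dimensional laws and invariance. -/

/-- A linear combination of values of `ψ` is again a Gaussian series, and its `∑ |c_m|²` is the
quadratic form of the kernel. Thus the covariance alone fixes the joint law. -/
theorem integral_cexp_su11 [IsProbabilityMeasure P] {L : ℕ} (hL : 1 ≤ L)
    (ha : ∀ m, HasLaw (a m) stdComplexGaussian P) (hindep : iIndepFun a P) {ι : Type*}
    (s : Finset ι) (t : ι → ℂ) (p : ι → 𝔻) :
    ∫ ω, cexp ((∑ i ∈ s, t i * su11Fun L (fun m => a m ω) (p i)).re * I) ∂P
      = cexp (-((∑ i ∈ s, ∑ j ∈ s, t i * conj (t j)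
        * (1 / (1 - (p i : ℂ) * conj (p j : ℂ)) ^ L)).re / 4 : ℝ)) := by
  refine integral_cexp_series ha hindep (c := fun m => ∑ i ∈ s, t i * su11Coef L (p i) m) ?_ ?_
  · have h : HasSum (fun m => ∑ i ∈ s, ∑ j ∈ s, t i * conj (t j) *
        (su11Coef L (p i) m * conj (su11Coef L (p j) m))) (∑ i ∈ s, ∑ j ∈ s, t i * conj (t j)
        * (1 / (1 - (p i : ℂ) * conj (p j : ℂ)) ^ L)) :=
      hasSum_sum fun i _ => hasSum_sum fun j _ =>
        (hasSum_su11Coef_mul_conj hL (p i) (p j)).mul_left _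
    convert! Complex.hasSum_re h using 2 with m
    rw [← Complex.normSq_eq_norm_sq, ← Complex.ofReal_re (normSq _), ← Complex.mul_conj, map_sum,
      Finset.sum_mul_sum]
    congr 1
    refine Finset.sum_congr rfl fun i _ => Finset.sum_congr rfl fun j _ => ?_
    rw [map_mul]
    ring
  · filter_upwards [ae_all_iff.2 fun i : s => ae_hasSum_su11Fun hL ha hindep (p i)] with ω h
    simp_rw [Finset.mul_sum]
    refine hasSum_sum fun i hi => ?_
    convert! (h ⟨i, hi⟩).mul_left (t i) using 2 with m
    ring

theorem aemeasurable_su11Fun [IsProbabilityMeasure P] {L : ℕ} (hL : 1 ≤ L)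
    (ha : ∀ m, HasLaw (a m) stdComplexGaussian P) (hindep : iIndepFun a P) (z : 𝔻) :
    AEMeasurable (fun ω => su11Fun L (fun m => a m ω) z) P :=
  aemeasurable_of_series ha (ae_hasSum_su11Fun hL ha hindep z)

/-- A law on sequences is determined by its finite marginals and these by their characteristic
functions; every real linear functional of finitely many complex coordinates is `v ↦ Re ∑ t_i v_i`.
-/
theorem identDistrib_of_integral_cexp [IsProbabilityMeasure P] {X Y : ℕ → Ω → ℂ}
    (hX : ∀ n, AEMeasurable (X n) P) (hY : ∀ n, AEMeasurable (Y n) P)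
    (h : ∀ (s : Finset ℕ) (t : ℕ → ℂ), ∫ ω, cexp ((∑ i ∈ s, t i * X i ω).re * I) ∂P
      = ∫ ω, cexp ((∑ i ∈ s, t i * Y i ω).re * I) ∂P) :
    IdentDistrib (fun ω n => X n ω) (fun ω n => Y n ω) P P := by
  have hX' : AEMeasurable (fun ω n => X n ω) P := aemeasurable_pi_lambda _ hX
  have hY' : AEMeasurable (fun ω n => Y n ω) P := aemeasurable_pi_lambda _ hY
  refine ⟨hX', hY', (map_eq_iff_forall_finset_map_restrict_eq hX' hY').2 fun s => ?_⟩
  have hXs : AEMeasurable (fun ω => s.restrict (X · ω)) P :=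
    (Finset.measurable_restrict s).comp_aemeasurable hX'
  have hYs : AEMeasurable (fun ω => s.restrict (Y · ω)) P :=
    (Finset.measurable_restrict s).comp_aemeasurable hY'
  have := Measure.isProbabilityMeasure_map hXs
  have := Measure.isProbabilityMeasure_map hYs
  apply Measure.ext_of_charFunDual
  ext ℓ
  classical
  -- The functional `v ↦ Re (t v)` takes the values `Re t` at `1` and `-Im t` at `I`, which dictates
  -- the coefficients.
  set t : ℕ → ℂ := fun i => if hi : i ∈ s then
    ⟨ℓ (Pi.single ⟨i, hi⟩ 1), -ℓ (Pi.single ⟨i, hi⟩ I)⟩ else 0 with ht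
  have key : ∀ v : ℕ → ℂ, ℓ (s.restrict v) = (∑ i ∈ s, t i * v i).re := by
    intro v
    have e : s.restrict v = ∑ i : s, ((v i).re • (Pi.single i 1 : s → ℂ)
        + (v i).im • (Pi.single i I : s → ℂ)) := by
      ext j
      simp only [Finset.restrict, Finset.sum_apply, Pi.add_apply, Pi.smul_apply]
      rw [Finset.sum_eq_single j (fun i _ hij => by simp [hij.symm]) (by simp)]
      simp
    rw [e, map_sum, ← Finset.sum_attach s, Complex.re_sum]
    refine Finset.sum_congr rfl fun i _ => ?_
    rw [map_add, map_smul, map_smul, ht]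
    simp [mul_re]
    ring
  rw [charFunDual_apply, charFunDual_apply, integral_map hXs
    (by apply Measurable.aestronglyMeasurable; fun_prop), integral_map hYs
    (by apply Measurable.aestronglyMeasurable; fun_prop)]
  simp_rw [key]
  exact h s t

theorem SU11.pullback_kernel (A : SU11) (L : ℕ) (z w : 𝔻) :
    (mobDen A.1.1 z)⁻¹ ^ L * conj ((mobDen A.1.1 w)⁻¹ ^ L)
      * (1 / (1 - ((A • z : 𝔻) : ℂ) * conj ((A • w : 𝔻) : ℂ)) ^ L)
      = 1 / (1 - (z : ℂ) * conj (w : ℂ)) ^ L := by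
  have hz := SU11.den_ne_zero A z
  have hw : conj (mobDen A.1.1 w) ≠ 0 := (map_ne_zero _).2 (SU11.den_ne_zero A w)
  have h := SU11.den_mul_conj_sub A z w
  change _ * _ * (1 / (1 - mobNum A.1.1 z / mobDen A.1.1 z
    * conj (mobNum A.1.1 w / mobDen A.1.1 w)) ^ L) = _
  rw [← h, map_pow, map_inv₀, map_div₀, ← mul_pow, ← one_div_pow, ← mul_pow, ← one_div_pow]
  congr 1
  rw [← mul_inv, ← one_div, one_div_mul_one_div]
  congr 1
  field_simp

theorem identDistrib_denseValues_pullback [IsProbabilityMeasure P] {L : ℕ} (hL : 1 ≤ L)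
    (ha : ∀ m, HasLaw (a m) stdComplexGaussian P) (hindep : iIndepFun a P) (A : SU11) :
    IdentDistrib (fun ω => denseValues (su11Fun L fun m => a m ω))
      (fun ω => denseValues (SU11.pullback A L (su11Fun L fun m => a m ω))) P P := by
  have hm := fun z => aemeasurable_su11Fun hL ha hindep z
  refine identDistrib_of_integral_cexp (fun n => hm _)
    (fun n => (hm (A • TopologicalSpace.denseSeq 𝔻 n)).const_mul _) fun s t => ?_
  have h1 := integral_cexp_su11 hL ha hindep s t (TopologicalSpace.denseSeq 𝔻)
  -- The weights are absorbed into the coefficients, so the pull-back is a combination of values of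
  -- `ψ` at the moved points.
  have h2 := integral_cexp_su11 hL ha hindep s
    (fun i => t i * (mobDen A.1.1 (TopologicalSpace.denseSeq 𝔻 i))⁻¹ ^ L)
    (fun i => A • TopologicalSpace.denseSeq 𝔻 i)
  simp_rw [mul_assoc] at h2
  refine h1.trans (Eq.trans ?_ h2.symm)
  refine congrArg (fun x : ℂ => cexp (-(x.re / 4 : ℝ))) ?_
  refine Finset.sum_congr rfl fun i _ => Finset.sum_congr rfl fun j _ => ?_
  rw [← SU11.pullback_kernel A, map_mul]
  ring

/-- The zeros of `ψ` and of its pull-back agree in law; pushing both forward by `A` turns the latter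
into the zeros of `ψ`. -/
theorem identDistrib_map_zeroMeasure [IsProbabilityMeasure P] {L : ℕ} (hL : 1 ≤ L)
    (ha : ∀ m, HasLaw (a m) stdComplexGaussian P) (hindep : iIndepFun a P) (A : SU11) :
    IdentDistrib (fun ω => (zeroMeasure (su11Fun L fun m => a m ω)).map (fun z : 𝔻 => A • z))
      (fun ω => zeroMeasure (su11Fun L fun m => a m ω)) P P := by
  have hgood := (ae_isGoodSequence hL ha hindep).mono fun ω h => h.isNonzeroAnalytic
  have h1 := identDistrib_zeroMeasure hgood
    (hgood.mono fun ω h => SU11.isNonzeroAnalytic_pullback A L h)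
    (identDistrib_denseValues_pullback hL ha hindep A)
  have h2 := h1.comp (Measure.measurable_map _ (SU11.continuous_smul A).measurable)
  refine h2.trans (IdentDistrib.of_ae_eq h2.aemeasurable_snd ?_)
  filter_upwards [hgood] with ω h
  exact SU11.map_zeroMeasure_pullback A L h.1

theorem integral_su11Fun_mul_conj [IsProbabilityMeasure P] {L : ℕ} (hL : 1 ≤ L)
    (ha : ∀ m, HasLaw (a m) stdComplexGaussian P) (hindep : iIndepFun a P) (z w : 𝔻) :
    ∫ ω, su11Fun L (fun m => a m ω) z * conj (su11Fun L (fun m => a m ω) w) ∂P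
      = 1 / (1 - (z : ℂ) * conj (w : ℂ)) ^ L := by
  rw [integral_mul_conj_series ha hindep (summable_norm_sq_su11Coef hL z)
    (summable_norm_sq_su11Coef hL w) (ae_hasSum_su11Fun hL ha hindep z)
    (ae_hasSum_su11Fun hL ha hindep w), (hasSum_su11Coef_mul_conj hL z w).tsum_eq]

end

end

theorem mainTheorem4 {Ω : Type*} [MeasurableSpace Ω] (P : Measure Ω) [IsProbabilityMeasure P]
    (L : ℕ) (hL : 1 ≤ L) (a : ℕ → Ω → ℂ)
    (ha : ∀ m, HasLaw (a m) stdComplexGaussian P) (hindep : iIndepFun a P) :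
    -- almost surely the series converges on the whole disk, to a function whose zeros
    -- do not accumulate in the disk
    (∀ᵐ ω ∂P, (∀ z : 𝔻, Summable (su11Term L (fun m => a m ω) z)) ∧
      IsLocallyFiniteMeasure (zeroMeasure (su11Fun L fun m => a m ω))) ∧
    -- the covariance function
    (∀ z w : 𝔻, ∫ ω, su11Fun L (fun m => a m ω) z * conj (su11Fun L (fun m => a m ω) w) ∂P
      = 1 / (1 - (z : ℂ) * conj (w : ℂ)) ^ L) ∧
    ∀ A : SU11,
      -- the random set of zeros (with multiplicity) and its image under `A` have the same law
      IdentDistrib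
        (fun ω => (zeroMeasure (su11Fun L fun m => a m ω)).map (fun z : 𝔻 => A • z))
        (fun ω => zeroMeasure (su11Fun L fun m => a m ω)) P P ∧
      -- joint distributions of the numbers of zeros in Borel sets
      (∀ (n : ℕ) (B : Fin n → Set 𝔻), (∀ i, MeasurableSet (B i)) →
        IdentDistrib
          (fun ω i => zeroMeasure (su11Fun L fun m => a m ω) ((fun z : 𝔻 => A • z) '' B i))
          (fun ω i => zeroMeasure (su11Fun L fun m => a m ω) (B i)) P P) ∧
      -- joint (n-point) distributions of zeros, tested against products of functions
      (∀ (n : ℕ) (φ : Fin n → 𝔻 → ℝ≥0∞), (∀ i, Measurable (φ i)) →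
        ∫⁻ ω, ∏ i, ∫⁻ z, φ i (A • z) ∂(zeroMeasure (su11Fun L fun m => a m ω)) ∂P
          = ∫⁻ ω, ∏ i, ∫⁻ z, φ i z ∂(zeroMeasure (su11Fun L fun m => a m ω)) ∂P) := by
  have hgood := ae_isGoodSequence hL ha hindep
  refine ⟨?_, integral_su11Fun_mul_conj hL ha hindep, fun A => ?_⟩
  · filter_upwards [hgood] with ω h
    obtain ⟨h1, h2⟩ := h.isNonzeroAnalytic
    exact ⟨fun z => (h.1 z).of_norm, isLocallyFiniteMeasure_zeroMeasure h1 h2⟩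
  have hid := identDistrib_map_zeroMeasure hL ha hindep A
  refine ⟨hid, fun n B hB => ?_, fun n φ hφ => ?_⟩
  -- The image of a set under `A` is its preimage under `A⁻¹`, so the counts are those of the
  -- measure pushed forward by `A⁻¹`.
  · have hid' := identDistrib_map_zeroMeasure hL ha hindep A⁻¹
    have hm : Measurable fun (ν : Measure 𝔻) (i : Fin n) => ν (B i) :=
      measurable_pi_lambda _ fun i => Measure.measurable_coe (hB i)
    have himg : ∀ i, (fun z : 𝔻 => A • z) '' B i = (fun z : 𝔻 => A⁻¹ • z) ⁻¹' B i :=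
      fun i => (MulAction.toPerm A : Equiv.Perm 𝔻).image_eq_preimage_symm (B i)
    have h := hid'.comp hm
    simp only [Function.comp_def,
      Measure.map_apply (SU11.continuous_smul A⁻¹).measurable (hB _)] at h
    simp_rw [himg]
    exact h
  · have hm : Measurable fun ν : Measure 𝔻 => ∏ i, ∫⁻ z, φ i z ∂ν :=
      Finset.measurable_prod _ fun i _ => Measure.measurable_lintegral (hφ i)
    have h := (hid.comp hm).lintegral_eq
    simp only [Function.comp_def,
      lintegral_map (hφ _) (SU11.continuous_smul A).measurable] at h
    exact h
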